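/- Let $k\ge 1$, $\Sigma=\{1,\dots,k\}$, and let $\sigma:\Sigma^{\mathbb N}\to\Sigma^{\mathbb N}$ be the left shift on the one-sided full shift, with the metric $d(x,y)=2^{-N}$ where $N$ is the first index at which $x\neq y$ differ. For a function $\varphi$ put $S_n\varphi=\sum_{j=0}^{n-1}\varphi\circ\sigma^j$; for $w\in\Sigma^n$ let $C_w$ be the cylinder of sequences beginning with $w$, and for $x\in\Sigma^{\mathbb N}$ let $C_n(x)$ be the cylinder of sequences with the same first $n$ symbols as $x$. Let $P(\varphi)$ be the topological pressure of $\varphi$ with respect to $\sigma$. Definitions. A sequence $(f_n)_{n\ge1}$ of real functions on $\Sigma^{\mathbb N}$ is *almost additive* if there is $C>0$ with $-C+f_m+f_n\circ\sigma^m\le f_{m+n}\le C+f_m+f_n\circ\sigma^m$ for all $m,n\ge1$. It has *bounded variation* if there are $M,\varepsilon>0$ such that for all $n\ge 1$ and all $x,y$, $d(\sigma^jx,\sigma^jy)<\varepsilon$ for $0\le j<n$ implies $|f_n(x)-f_n(y)|\le M$. It has the *Walters property* if for every $\kappa>0$ there is $\varepsilon>0$ such that for all $n\ge 1$ and all $x,y$,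 $d(\sigma^jx,\sigma^jy)<\varepsilon$ for $0\le j<n$ implies $|f_n(x)-f_n(y)|<\kappa$. A function $\varphi$ is *Bowen* if $(S_n\varphi)_n$ has bounded variation. A continuous function is a *weak coboundary* if it is a uniform limit of functions $q\circ\sigma-q$ with $q$ continuous. A Borel probability measure $\nu$ on $\Sigma^{\mathbb N}$ is *Gibbs* with respect to $\xi$ if there is $K\ge1$ with $K^{-1}\le \nu(C_n(x))/\exp(-nP(\xi)+S_n\xi(x))\le K$ for all $x$ and all $n\ge1$. It is *quasi-Bernoulli* if $\nu(C_j)>0$ for all $j\in\Sigma$ and there is $C\ge1$ with $C^{-1}\le \nu(C_{wv})/(\nu(C_w)\nu(C_v))\le C$ for all non-empty finite words $w,v$, where $wv$ is the concatenation. Proposition. Let $\varphi=u+\xi$, where $u:\Sigma^{\mathbb N}\to\mathbb R$ is a weak coboundary and $\xi:\Sigma^{\mathbb N}\to\mathbb R$ is a continuous Bowen function. Then there is a $\sigma$-invariant Borel probability measure $\nu$ on $\Sigma^{\mathbb N}$, Gibbs with respect to $\xi$ and quasi-Bernoulli, such that the functions $$f_n(x)=\log\nu(C_n(x))+nP(\xi)\qquad(n\ge1)$$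 form an almost additive sequence of continuous functions with the Walters property and $$\lim_{n\to\infty}\frac1n\|f_n-S_n\varphi\|_\infty=0 .$$ If moreover $\varphi$ is itself Bowen, then $\sup_{n\ge1}\|f_n-S_n\varphi\|_\infty<\infty$. -/

import Mathlib

open MeasureTheory Filter Topology
open scoped ENNReal

noncomputable section

namespace Thermo

section General

variable {X : Type*}

/-- `IsAlmostAdditive T f`: for some constant `C > 0`,
`-C + f_m + f_n ∘ T^m ≤ f_{m+n} ≤ C + f_m + f_n ∘ T^m` for all `m, n ≥ 1`. Sequences are indexed by
`n ≥ 1`; the entry at `0` plays no role here or below. -/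
def IsAlmostAdditive (T : X → X) (f : ℕ → X → ℝ) : Prop :=
  ∃ C : ℝ, 0 < C ∧ ∀ m n : ℕ, 1 ≤ m → 1 ≤ n → ∀ x : X,
    -C + f m x + f n (T^[m] x) ≤ f (m + n) x ∧ f (m + n) x ≤ C + f m x + f n (T^[m] x)

/-- Bounded variation of a sequence of functions. -/
def HasBoundedVariation [MetricSpace X] (T : X → X) (f : ℕ → X → ℝ) : Prop :=
  ∃ M : ℝ, 0 < M ∧ ∃ ε : ℝ, 0 < ε ∧ ∀ n : ℕ, 1 ≤ n → ∀ x y : X,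
    (∀ j < n, dist (T^[j] x) (T^[j] y) < ε) → |f n x - f n y| ≤ M

/-- The Walters property of a sequence of functions. -/
def HasWaltersProperty [MetricSpace X] (T : X → X) (f : ℕ → X → ℝ) : Prop :=
  ∀ κ : ℝ, 0 < κ → ∃ ε : ℝ, 0 < ε ∧ ∀ n : ℕ, 1 ≤ n → ∀ x y : X,
    (∀ j < n, dist (T^[j] x) (T^[j] y) < ε) → |f n x - f n y| < κ

/-- A function is Bowen if its sequence of Birkhoff sums `S_n φ` has bounded variation. -/
def IsBowen [MetricSpace X] (T : X → X) (φ : X → ℝ) : Prop :=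
  HasBoundedVariation T (birkhoffSum T φ)

/-- `E` is `(n, ε)`-separated: distinct points of `E` are at distance at least `ε` for the metric
`d_n(x, y) = max_{0 ≤ j < n} d(T^j x, T^j y)`. -/
def IsSeparated [MetricSpace X] (T : X → X) (n : ℕ) (ε : ℝ) (E : Finset X) : Prop :=
  ∀ x ∈ E, ∀ y ∈ E, x ≠ y → ∃ j < n, ε ≤ dist (T^[j] x) (T^[j] y)

/-- The supremum of `∑_{x ∈ E} exp (S_n φ x)` over the finite `(n, ε)`-separated sets `E`. -/
def partitionSup [MetricSpace X] (T : X → X) (φ : X → ℝ) (ε : ℝ) (n : ℕ) : ℝ≥0∞ :=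
  ⨆ (E : Finset X) (_ : IsSeparated T n ε E),
    ∑ x ∈ E, ENNReal.ofReal (Real.exp (birkhoffSum T φ n x))

/-- The classical topological pressure, as an extended real: the limit (a supremum) as `ε → 0` of
`limsup_n (1/n) log sup_E ∑_{x ∈ E} exp (S_n φ x)`, over `(n, ε)`-separated sets `E`. -/
def extPressure [MetricSpace X] (T : X → X) (φ : X → ℝ) : EReal :=
  ⨆ (ε : ℝ) (_ : 0 < ε), limsup (fun n : ℕ => ENNReal.log (partitionSup T φ ε n) / (n : EReal)) atTop

/-- The topological pressure as a real number. For a bounded `φ` on a non-empty full shift over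
finitely many symbols, `extPressure` is finite. -/
def pressure [MetricSpace X] (T : X → X) (φ : X → ℝ) : ℝ :=
  (extPressure T φ).toReal

variable [TopologicalSpace X]

/-- The Birkhoff sum `S_n φ = ∑_{j < n} φ ∘ T^j` as a continuous function. -/
def birkhoffSumC (T : C(X, X)) (φ : C(X, ℝ)) (n : ℕ) : C(X, ℝ) where
  toFun := birkhoffSum T φ n
  continuous_toFun :=
    continuous_finsetSum _ fun i _ => φ.continuous.comp (T.continuous.iterate i)

variable [CompactSpace X]

/-- A continuous function is a coboundary if it equals `q ∘ T - q` for a continuous `q`. -/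
def IsCoboundary (T : C(X, X)) (u : C(X, ℝ)) : Prop :=
  ∃ q : C(X, ℝ), ∀ x, u x = q (T x) - q x

/-- A weak coboundary is a uniform limit of coboundaries (the topology of `C(X, ℝ)`, for compact
`X`, is that of uniform convergence). -/
def IsWeakCoboundary (T : C(X, X)) (u : C(X, ℝ)) : Prop :=
  u ∈ closure {v : C(X, ℝ) | IsCoboundary T v}

/-- Physical equivalence: `‖f_n - g_n‖_∞ / n → 0`. -/
def PhysicallyEquivalent (f g : ℕ → C(X, ℝ)) : Prop :=
  Tendsto (fun n : ℕ => ‖f n - g n‖ / (n : ℝ)) atTop (𝓝 0)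

end General

/-- The space of one-sided sequences over an alphabet with `k` symbols, with the product topology
and the product σ-algebra. -/
abbrev FullShift (k : ℕ) : Type := ℕ → Fin k

/-- The metric `d(x, y) = 2^{-N}`, where `N` is the first index at which `x` and `y` differ; it
induces the product topology. -/
instance (k : ℕ) : MetricSpace (FullShift k) := PiNat.metricSpace

/-- The left shift `(i₁ i₂ i₃ ⋯) ↦ (i₂ i₃ i₄ ⋯)`. -/
def shift (k : ℕ) : C(FullShift k, FullShift k) where
  toFun x := fun i => x (i + 1)
  continuous_toFun := continuous_pi fun i => continuous_apply (i + 1)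

/-- The cylinder of all sequences that begin with the word `w`. -/
def cyl {k n : ℕ} (w : Fin n → Fin k) : Set (FullShift k) :=
  {x | ∀ i : Fin n, x i = w i}

/-- The word formed by the first `n` symbols of `x`. -/
def pre {k : ℕ} (x : FullShift k) (n : ℕ) : Fin n → Fin k := fun i => x i

/-- `μ` is Gibbs with respect to `φ`. -/
def IsGibbs {k : ℕ} (μ : Measure (FullShift k)) (φ : FullShift k → ℝ) : Prop :=
  ∃ K : ℝ, 1 ≤ K ∧ ∀ n : ℕ, 1 ≤ n → ∀ w : Fin n → Fin k, ∀ x ∈ cyl w,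
    K⁻¹ ≤ μ.real (cyl w) /
        Real.exp (-(n * pressure (shift k) φ) + birkhoffSum (shift k) φ n x) ∧
      μ.real (cyl w) /
        Real.exp (-(n * pressure (shift k) φ) + birkhoffSum (shift k) φ n x) ≤ K

/-- `μ` is quasi-Bernoulli. -/
def IsQuasiBernoulli {k : ℕ} (μ : Measure (FullShift k)) : Prop :=
  (∀ w : Fin 1 → Fin k, 0 < μ.real (cyl w)) ∧
  ∃ C : ℝ, 1 ≤ C ∧ ∀ n m : ℕ, 1 ≤ n → 1 ≤ m → ∀ (w : Fin n → Fin k) (v : Fin m → Fin k),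
    C⁻¹ ≤ μ.real (cyl (Fin.append w v)) / (μ.real (cyl w) * μ.real (cyl v)) ∧
      μ.real (cyl (Fin.append w v)) / (μ.real (cyl w) * μ.real (cyl v)) ≤ C

end Thermo

end

open Thermo

/-! On the full shift the Bowen condition says that S_n ξ is determined, up to a constant M, by the
first n symbols. Hence Z_n = `transfer ξ n 1 o`, a sum of exp(S_n ξ) over words of length n, is
multiplicative up to e^M. Fekete's lemma makes log Z_n linear up to M, and comparison with separated
sets identifies the slope as the pressure (`abs_log_transfer_sub_le`).

The same splitting at word boundaries shows that weighted point masses on long words give a word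
sitting anywhere inside the block its Gibbs weight, up to e^(5M) and independently of its position
(`wordMeasure_cyl_bounds`). Averaging over positions and taking a weak limit yields an invariant
Gibbs measure, with no need for an eigenfunction of the transfer operator.

Taking logarithms, f_n stays within a constant of S_n ξ. Quasi-Bernoulli and almost additivity
follow, and the Walters property is immediate because f_n depends on n symbols only. What is left is
S_n u: it is o(n) by approximation with coboundaries. If φ is Bowen then S_n u varies boundedly on
cylinders, and it vanishes at the n-periodic point of each cylinder, so it is bounded. -/

namespace Thermo

/-! ### Words, cylinders and variation on cylinders -/

section Symbols

variable {k : ℕ}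

theorem dist_le_of_agree {x y : FullShift k} {p : ℕ} (h : ∀ i < p, x i = y i) :
    dist x y ≤ (1 / 2 : ℝ) ^ p := by
  have : x ∈ PiNat.cylinder y p := fun i hi => h i hi
  exact PiNat.mem_cylinder_iff_dist_le.1 this

theorem apply_zero_eq_of_dist_lt_one {x y : FullShift k} (h : dist x y < 1) : x 0 = y 0 := by
  have h' : dist x y < (1 / 2 : ℝ) ^ 0 := by simpa using h
  exact PiNat.apply_eq_of_dist_lt h' le_rfl

theorem shift_iterate_apply (j : ℕ) (x : FullShift k) (i : ℕ) :
    (shift k)^[j] x i = x (i + j) := by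
  induction j generalizing x with
  | zero => rfl
  | succ j ih =>
    rw [Function.iterate_succ_apply, ih]
    change x (i + j + 1) = _
    rw [add_assoc]

/-- The sequence obtained by writing the word `w` in front of `x`. -/
def prepend {n : ℕ} (w : Fin n → Fin k) (x : FullShift k) : FullShift k :=
  fun i => if h : i < n then w ⟨i, h⟩ else x (i - n)

theorem prepend_apply_fin {n : ℕ} (w : Fin n → Fin k) (x : FullShift k) (i : Fin n) :
    prepend w x i = w i := by
  simp [prepend]

theorem prepend_apply_add {n : ℕ} (w : Fin n → Fin k) (x : FullShift k) (i : ℕ) :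
    prepend w x (i + n) = x i := by
  simp [prepend]

theorem prepend_mem_cyl {n : ℕ} (w : Fin n → Fin k) (x : FullShift k) : prepend w x ∈ cyl w :=
  prepend_apply_fin w x

theorem prepend_mem_cyl_iff {n : ℕ} (w v : Fin n → Fin k) (x : FullShift k) :
    prepend v x ∈ cyl w ↔ v = w := by
  refine ⟨fun h => funext fun i => ?_, fun h => h ▸ prepend_mem_cyl v x⟩
  rw [← h i, prepend_apply_fin]

theorem shift_iterate_prepend {n : ℕ} (w : Fin n → Fin k) (x : FullShift k) :
    (shift k)^[n] (prepend w x) = x := by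
  ext i
  rw [shift_iterate_apply, prepend_apply_add]

theorem eq_on_of_mem_cyl {n : ℕ} {w : Fin n → Fin k} {x y : FullShift k} (hx : x ∈ cyl w)
    (hy : y ∈ cyl w) : ∀ i < n, x i = y i :=
  fun i hi => (hx ⟨i, hi⟩).trans (hy ⟨i, hi⟩).symm

theorem mem_cyl_append_iff {m n : ℕ} (w : Fin m → Fin k) (v : Fin n → Fin k) (x : FullShift k) :
    x ∈ cyl (Fin.append w v) ↔ x ∈ cyl w ∧ (shift k)^[m] x ∈ cyl v := by
  constructor
  · intro h
    refine ⟨fun i => ?_, fun i => ?_⟩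
    · simpa using h (Fin.castAdd n i)
    · rw [shift_iterate_apply, add_comm]
      simpa using h (Fin.natAdd m i)
  · rintro ⟨h₁, h₂⟩ i
    refine Fin.addCases (fun i => ?_) (fun i => ?_) i
    · simpa using h₁ i
    · have := h₂ i
      rw [shift_iterate_apply, add_comm] at this
      simpa using this

theorem prepend_append {m n : ℕ} (w : Fin m → Fin k) (v : Fin n → Fin k) (x : FullShift k) :
    prepend (Fin.append w v) x = prepend w (prepend v x) := by
  ext i
  congr 1
  rcases lt_or_ge i m with hi | hi
  · have h₁ := prepend_apply_fin (Fin.append w v) x (Fin.castAdd n ⟨i, hi⟩)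
    have h₂ := prepend_apply_fin w (prepend v x) ⟨i, hi⟩
    simp only [Fin.val_castAdd, Fin.append_left] at h₁ h₂
    rw [h₁, h₂]
  · obtain ⟨i, rfl⟩ := Nat.exists_eq_add_of_le' hi
    rw [prepend_apply_add]
    rcases lt_or_ge i n with hi | hi
    · have h₁ := prepend_apply_fin (Fin.append w v) x (Fin.natAdd m ⟨i, hi⟩)
      have h₂ := prepend_apply_fin v x ⟨i, hi⟩
      simp only [Fin.val_natAdd, Fin.append_right] at h₁ h₂
      rw [h₂, ← h₁]
      exact congrArg _ (add_comm i m)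
    · obtain ⟨i, rfl⟩ := Nat.exists_eq_add_of_le' hi
      rw [prepend_apply_add, add_assoc, add_comm n m, prepend_apply_add]

theorem mem_cyl_pre (x : FullShift k) (n : ℕ) : x ∈ cyl (pre x n) := fun _ => rfl

theorem append_pre (x : FullShift k) (m n : ℕ) :
    Fin.append (pre x m) (pre ((shift k)^[m] x) n) = pre x (m + n) := by
  ext i
  congr 1
  exact ((mem_cyl_append_iff _ _ x).2 ⟨mem_cyl_pre _ _, mem_cyl_pre _ _⟩ i).symm

theorem isClopen_cyl {n : ℕ} (w : Fin n → Fin k) : IsClopen (cyl w) := by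
  have : cyl w = ⋂ i : Fin n, (fun x : FullShift k => x i) ⁻¹' {w i} := by
    ext x; simp [cyl]
  rw [this]
  exact isClopen_iInter_of_finite fun i =>
    (isClopen_discrete _).preimage (continuous_apply (i : ℕ))

theorem norm_birkhoffSum_le (φ : C(FullShift k, ℝ)) (n : ℕ) (x : FullShift k) :
    |birkhoffSum (shift k) φ n x| ≤ n * ‖φ‖ := by
  rw [birkhoffSum]
  refine (Finset.abs_sum_le_sum_abs _ _).trans ?_
  refine (Finset.sum_le_sum fun i _ => φ.norm_coe_le_norm ((shift k)^[i] x)).trans ?_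
  simp

/-- The Birkhoff sums of `φ` oscillate by at most `M` on every cylinder of the matching length. -/
def CylVariationLE (φ : FullShift k → ℝ) (M : ℝ) : Prop :=
  ∀ (n : ℕ) (x y : FullShift k), (∀ i < n, x i = y i) →
    |birkhoffSum (shift k) φ n x - birkhoffSum (shift k) φ n y| ≤ M

/-- The Birkhoff sums of a continuous Bowen function have uniformly bounded oscillation on
cylinders. -/
theorem IsBowen.exists_cyl_bound {φ : C(FullShift k, ℝ)} (h : IsBowen (shift k) φ) :
    ∃ M : ℝ, 0 ≤ M ∧ CylVariationLE φ M := by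
  obtain ⟨M, hM, ε, hε, h⟩ := h
  obtain ⟨p, hp⟩ := exists_pow_lt_of_lt_one hε (by norm_num : (1 / 2 : ℝ) < 1)
  have hsub (x y : FullShift k) (m : ℕ) (hm : m ≤ p) :
      |birkhoffSum (shift k) φ m x - birkhoffSum (shift k) φ m y| ≤ 2 * (p * ‖φ‖) := by
    have hx := norm_birkhoffSum_le φ m x
    have hy := norm_birkhoffSum_le φ m y
    have : (m : ℝ) * ‖φ‖ ≤ p * ‖φ‖ := by gcongr
    exact (abs_sub _ _).trans (by linarith)
  refine ⟨M + 2 * (p * ‖φ‖), by positivity, fun n x y hxy => ?_⟩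
  rcases le_or_gt n p with hn | hn
  · exact (hsub x y n hn).trans (by linarith)
  · obtain ⟨m, rfl⟩ := Nat.exists_eq_add_of_le' hn.le
    rw [birkhoffSum_add, birkhoffSum_add, add_sub_add_comm]
    -- Agreement on m + p symbols keeps the first m iterates within 2^(-p) < ε, so the hypothesis
    -- covers them; the last p summands are bounded trivially.
    refine (abs_add_le _ _).trans (add_le_add (h m (by omega) x y fun j hj => ?_) (hsub _ _ p le_rfl))
    refine (dist_le_of_agree fun i hi => ?_).trans_lt hp
    rw [shift_iterate_apply, shift_iterate_apply]
    exact hxy _ (by omega)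

end Symbols

/-! ### Iterates of the transfer operator -/

section Transfer

variable {k : ℕ}

/-- The `n`-th iterate of the Ruelle transfer operator of the potential `ξ`. -/
noncomputable def transfer (ξ : FullShift k → ℝ) (n : ℕ) (g : FullShift k → ℝ)
    (x : FullShift k) : ℝ :=
  ∑ w : Fin n → Fin k, Real.exp (birkhoffSum (shift k) ξ n (prepend w x)) * g (prepend w x)

variable (ξ : FullShift k → ℝ)

theorem transfer_add (m n : ℕ) (g : FullShift k → ℝ) :
    transfer ξ (m + n) g = transfer ξ n (transfer ξ m g) := by
  ext x
  simp only [transfer]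
  rw [← (Fin.appendEquiv (α := Fin k) m n).sum_comp, Fintype.sum_prod_type_right]
  refine Finset.sum_congr rfl fun v _ => ?_
  rw [Finset.mul_sum]
  refine Finset.sum_congr rfl fun w _ => ?_
  change Real.exp (birkhoffSum (shift k) ξ (m + n) (prepend (Fin.append w v) x)) *
    g (prepend (Fin.append w v) x) = _
  rw [prepend_append, birkhoffSum_add, shift_iterate_prepend, Real.exp_add]
  ring

/-- Every point summed over is an n-th preimage of x, so f ∘ σ^n has the constant value f x there
and factors out. -/
theorem transfer_comp_mul (n : ℕ) (f g : FullShift k → ℝ) :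
    transfer ξ n (fun x => f ((shift k)^[n] x) * g x) = fun x => f x * transfer ξ n g x := by
  ext x
  simp only [transfer, shift_iterate_prepend, Finset.mul_sum]
  exact Finset.sum_congr rfl fun w _ => by ring

theorem transfer_mono (n : ℕ) {f g : FullShift k → ℝ} (h : ∀ x, f x ≤ g x) (x : FullShift k) :
    transfer ξ n f x ≤ transfer ξ n g x :=
  Finset.sum_le_sum fun _ _ => mul_le_mul_of_nonneg_left (h _) (Real.exp_nonneg _)

theorem transfer_const_mul (n : ℕ) (c : ℝ) (g : FullShift k → ℝ) (x : FullShift k) :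
    transfer ξ n (fun y => c * g y) x = c * transfer ξ n g x := by
  simp only [transfer, Finset.mul_sum]
  exact Finset.sum_congr rfl fun w _ => by ring

theorem transfer_const (n : ℕ) (c : ℝ) (x : FullShift k) :
    transfer ξ n (fun _ => c) x = c * transfer ξ n 1 x := by
  simpa using transfer_const_mul ξ n c 1 x

theorem transfer_one_pos (n : ℕ) (x : FullShift k) : 0 < transfer ξ n 1 x := by
  have : Nonempty (Fin n → Fin k) := ⟨pre x n⟩
  exact Finset.sum_pos (fun _ _ => by simpa using Real.exp_pos _) Finset.univ_nonempty

theorem transfer_indicator_cyl {n : ℕ} (w : Fin n → Fin k) (x : FullShift k) :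
    transfer ξ n ((cyl w).indicator 1) x =
      Real.exp (birkhoffSum (shift k) ξ n (prepend w x)) := by
  classical
  rw [transfer, Finset.sum_eq_single w]
  · simp [prepend_mem_cyl]
  · intro v _ hv
    rw [Set.indicator_of_notMem (by rwa [prepend_mem_cyl_iff]), mul_zero]
  · simp

variable {ξ} {M : ℝ}

theorem exp_birkhoffSum_le (hM : CylVariationLE ξ M) {n : ℕ} {w : Fin n → Fin k} {x y : FullShift k} (hx : x ∈ cyl w)
    (hy : y ∈ cyl w) : Real.exp (birkhoffSum (shift k) ξ n x) ≤
      Real.exp M * Real.exp (birkhoffSum (shift k) ξ n y) := by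
  rw [← Real.exp_add, Real.exp_le_exp]
  linarith [(abs_le.1 (hM n x y (eq_on_of_mem_cyl hx hy))).2]

/-- The two sums match word by word, each pair of points lying in a common cylinder. This
near-independence of the base point is what makes the partition sums almost multiplicative. -/
theorem transfer_one_le (hM : CylVariationLE ξ M) (n : ℕ) (x y : FullShift k) :
    transfer ξ n 1 x ≤ Real.exp M * transfer ξ n 1 y := by
  simp only [transfer, Finset.mul_sum, Pi.one_apply, mul_one]
  exact Finset.sum_le_sum fun w _ =>
    exp_birkhoffSum_le hM (prepend_mem_cyl w x) (prepend_mem_cyl w y)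

theorem transfer_add_one_le (hM : CylVariationLE ξ M) (m n : ℕ) (x : FullShift k) :
    transfer ξ (m + n) 1 x ≤ Real.exp M * (transfer ξ m 1 x * transfer ξ n 1 x) := by
  rw [transfer_add, ← mul_assoc, ← transfer_const]
  exact transfer_mono ξ n (fun y => transfer_one_le hM m y x) x

theorem le_transfer_add_one (hM : CylVariationLE ξ M) (m n : ℕ) (x : FullShift k) :
    transfer ξ m 1 x * transfer ξ n 1 x ≤ Real.exp M * transfer ξ (m + n) 1 x := by
  rw [transfer_add, ← transfer_const, ← transfer_const_mul]
  exact transfer_mono ξ n (fun y => transfer_one_le hM m x y) x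

end Transfer

/-! ### Almost additive real sequences -/

section AlmostAdditiveReal

/-- A real sequence that is additive up to an error `c` is linear up to the same error. -/
theorem exists_abs_sub_mul_le {s : ℕ → ℝ} {c : ℝ}
    (h : ∀ m n, |s (m + n) - s m - s n| ≤ c) : ∃ P : ℝ, ∀ n : ℕ, |s n - n * P| ≤ c := by
  have hsub (m n : ℕ) := (abs_le.1 (h m n)).1
  have hsup (m n : ℕ) := (abs_le.1 (h m n)).2
  have h0 : |s 0| ≤ c := by simpa using h 0 0
  have hc : 0 ≤ c := (abs_nonneg _).trans h0
  have hgrow (n : ℕ) : |s n| ≤ c + n * (|s 1| + c) := by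
    induction n with
    | zero => simpa using h0
    | succ n ih =>
      have h₁ := le_abs_self (s 1)
      have h₂ := neg_abs_le (s 1)
      have h₃ := hsub n 1
      have h₄ := hsup n 1
      push_cast
      rw [abs_le] at ih ⊢
      constructor <;> linarith
  have hbdd (u : ℕ → ℝ) (hu : ∀ n, -|s n| ≤ u n) :
      BddBelow (Set.range fun n => u n / n) := by
    refine ⟨-(|s 1| + 2 * c), ?_⟩
    rintro _ ⟨n, rfl⟩
    rcases Nat.eq_zero_or_pos n with rfl | hn
    · simp only [Nat.cast_zero, div_zero, neg_nonpos]; positivity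
    · have hn' : (1 : ℝ) ≤ n := by exact_mod_cast hn
      rw [le_div_iff₀ (by positivity)]
      nlinarith [hgrow n, hu n]
  -- Both s + c and c - s are subadditive. Fekete's limits are infima, so they bound s n from below
  -- and from above; the limits are opposite because the two sequences sum to the constant 2c.
  have hu : Subadditive fun n => s n + c := fun m n => by linarith [hsup m n]
  have hv : Subadditive fun n => c - s n := fun m n => by linarith [hsub m n]
  have hub := hbdd (fun n => s n + c) fun n => by linarith [neg_abs_le (s n)]
  have hvb := hbdd (fun n => c - s n) fun n => by linarith [le_abs_self (s n)]
  have hlim : hv.lim = -hu.lim := by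
    have h₁ := (hu.tendsto_lim hub).add (hv.tendsto_lim hvb)
    have h₂ : Tendsto (fun n : ℕ => 2 * c / (n : ℝ)) atTop (𝓝 0) :=
      tendsto_const_div_atTop_nhds_zero_nat _
    have h₃ := tendsto_nhds_unique h₁ (h₂.congr fun n => by ring)
    linarith
  refine ⟨hu.lim, fun n => ?_⟩
  rcases Nat.eq_zero_or_pos n with rfl | hn
  · simpa using h0
  · have hn' : (0 : ℝ) < n := by exact_mod_cast hn
    have h₁ := hu.lim_le_div hub hn.ne'
    have h₂ := hv.lim_le_div hvb hn.ne'
    rw [le_div_iff₀ hn'] at h₁ h₂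
    rw [hlim] at h₂
    rw [abs_le]
    constructor <;> linarith

end AlmostAdditiveReal

/-! ### Exponential growth rates in the extended reals -/

section Limsup

variable {a : ℕ → ℝ≥0∞} {C P : ℝ}

theorem tendsto_log_exp_linear_div (C P : ℝ) :
    Tendsto (fun n : ℕ => ENNReal.log (ENNReal.ofReal (Real.exp (C + n * P))) / (n : EReal)) atTop
      (𝓝 (P : EReal)) := by
  have h₁ : Tendsto (fun n : ℕ => C / (n : ℝ) + P) atTop (𝓝 (0 + P)) :=
    (tendsto_const_div_atTop_nhds_zero_nat _).add_const P
  rw [zero_add] at h₁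
  refine (EReal.tendsto_coe.2 h₁).congr' ?_
  filter_upwards [eventually_gt_atTop 0] with n hn
  have hn' : (n : ℝ) ≠ 0 := by exact_mod_cast hn.ne'
  rw [ENNReal.log_ofReal_of_pos (Real.exp_pos _), Real.log_exp, ← EReal.coe_coe_eq_natCast,
    ← EReal.coe_div]
  congr 1
  field_simp

theorem limsup_log_div_le (h : ∀ n : ℕ, a n ≤ ENNReal.ofReal (Real.exp (C + n * P))) :
    limsup (fun n : ℕ => ENNReal.log (a n) / (n : EReal)) atTop ≤ P := by
  rw [← (tendsto_log_exp_linear_div C P).limsup_eq]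
  exact limsup_le_limsup (Eventually.of_forall fun n =>
    EReal.div_le_div_right_of_nonneg (by positivity) (ENNReal.log_le_log (h n)))

theorem le_limsup_log_div (h : ∀ n : ℕ, ENNReal.ofReal (Real.exp (C + n * P)) ≤ a n) :
    P ≤ limsup (fun n : ℕ => ENNReal.log (a n) / (n : EReal)) atTop := by
  rw [← (tendsto_log_exp_linear_div C P).limsup_eq]
  exact limsup_le_limsup (Eventually.of_forall fun n =>
    EReal.div_le_div_right_of_nonneg (by positivity) (ENNReal.log_le_log (h n)))

end Limsup

/-! ### Pressure as the growth rate of partition sums -/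

section Pressure

variable {k : ℕ}

/-- The points obtained by prefixing x with all words of length n are (n, 1)-separated: distance
below 1 forces equal first symbols. -/
theorem partitionSup_one_ge (ξ : FullShift k → ℝ) (n : ℕ) (x : FullShift k) :
    ENNReal.ofReal (transfer ξ n 1 x) ≤ partitionSup (shift k) ξ 1 n := by
  classical
  have hinj : Function.Injective fun w : Fin n → Fin k => prepend w x := fun w v h =>
    (prepend_mem_cyl_iff v w x).1 (by simpa only [h] using prepend_mem_cyl v x)
  refine le_trans ?_ (le_iSup₂ (Finset.univ.map ⟨_, hinj⟩) ?_)
  · rw [Finset.sum_map, ← ENNReal.ofReal_sum_of_nonneg fun _ _ => (Real.exp_nonneg _)]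
    simp [transfer]
  · simp only [IsSeparated, Finset.mem_map, Finset.mem_univ, true_and, Function.Embedding.coeFn_mk]
    rintro _ ⟨w, rfl⟩ _ ⟨v, rfl⟩ hne
    by_contra! hlt
    refine hne (congrArg (prepend · x) (funext fun i => ?_))
    have := apply_zero_eq_of_dist_lt_one (hlt i i.2)
    rwa [shift_iterate_apply, shift_iterate_apply, zero_add, prepend_apply_fin,
      prepend_apply_fin] at this

/-- Points sharing n + p symbols stay within 2^(-p) < ε for n steps, so a separated set injects into
words of length n + p. The p extra summands cost p‖ξ‖, and moving to the representative ending in o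
costs M. -/
theorem partitionSup_le {ξ : C(FullShift k, ℝ)} {M : ℝ} (hM : CylVariationLE ξ M) {ε : ℝ} {p : ℕ}
    (hp : (1 / 2 : ℝ) ^ p < ε) (n : ℕ) (o : FullShift k) :
    partitionSup (shift k) ξ ε n ≤
      ENNReal.ofReal (Real.exp (M + p * ‖ξ‖) * transfer ξ (n + p) 1 o) := by
  classical
  refine iSup₂_le fun E hE => ?_
  rw [← ENNReal.ofReal_sum_of_nonneg fun _ _ => (Real.exp_nonneg _)]
  refine ENNReal.ofReal_le_ofReal ?_
  have hinj : Set.InjOn (fun x : FullShift k => pre x (n + p)) E := by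
    intro x hx y hy hxy
    by_contra hne
    obtain ⟨j, hj, hd⟩ := hE x hx y hy hne
    refine absurd (hp.trans_le hd) (not_lt.2 (dist_le_of_agree fun i hi => ?_))
    rw [shift_iterate_apply, shift_iterate_apply]
    exact congrFun hxy ⟨i + j, by omega⟩
  have hterm (x : FullShift k) : Real.exp (birkhoffSum (shift k) ξ n x) ≤
      Real.exp (M + p * ‖ξ‖) *
        Real.exp (birkhoffSum (shift k) ξ (n + p) (prepend (pre x (n + p)) o)) := by
    rw [← Real.exp_add, Real.exp_le_exp]
    have h₁ := (abs_le.1 (hM (n + p) x (prepend (pre x (n + p)) o)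
      (eq_on_of_mem_cyl (mem_cyl_pre x _) (prepend_mem_cyl _ o)))).2
    have h₂ := (abs_le.1 (norm_birkhoffSum_le ξ p ((shift k)^[n] x))).1
    rw [birkhoffSum_add (shift k) ξ n p x] at h₁
    linarith
  calc ∑ x ∈ E, Real.exp (birkhoffSum (shift k) ξ n x)
      ≤ ∑ x ∈ E, Real.exp (M + p * ‖ξ‖) *
        Real.exp (birkhoffSum (shift k) ξ (n + p) (prepend (pre x (n + p)) o)) :=
        Finset.sum_le_sum fun x _ => hterm x
    _ = ∑ w ∈ E.image (fun x => pre x (n + p)), Real.exp (M + p * ‖ξ‖) *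
        Real.exp (birkhoffSum (shift k) ξ (n + p) (prepend w o)) :=
        (Finset.sum_image (f := fun w => Real.exp (M + p * ‖ξ‖) *
          Real.exp (birkhoffSum (shift k) ξ (n + p) (prepend w o))) hinj).symm
    _ ≤ ∑ w : Fin (n + p) → Fin k, Real.exp (M + p * ‖ξ‖) *
        Real.exp (birkhoffSum (shift k) ξ (n + p) (prepend w o)) :=
        Finset.sum_le_sum_of_subset_of_nonneg (Finset.subset_univ _) fun _ _ _ => by positivity
    _ = _ := by simp [transfer, Finset.mul_sum]

/-- On the full shift, the pressure of a continuous potential with bounded oscillation on cylinders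
is the exponential growth rate of the iterates of the transfer operator. -/
theorem pressure_eq_of_transfer {ξ : C(FullShift k, ℝ)} {M c P : ℝ} (hM : CylVariationLE ξ M)
    (o : FullShift k) (hP : ∀ n : ℕ, |Real.log (transfer ξ n 1 o) - n * P| ≤ c) :
    pressure (shift k) ξ = P := by
  have hpos (n : ℕ) := transfer_one_pos ξ n o
  suffices h : extPressure (shift k) ξ = P by rw [pressure, h, EReal.toReal_coe]
  refine le_antisymm (iSup₂_le fun ε hε => ?_) ?_
  · obtain ⟨p, hp⟩ := exists_pow_lt_of_lt_one hε (by norm_num : (1 / 2 : ℝ) < 1)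
    refine limsup_log_div_le (C := M + p * ‖ξ‖ + c + p * P) fun n : ℕ =>
      (partitionSup_le hM hp n o).trans (ENNReal.ofReal_le_ofReal ?_)
    rw [← Real.exp_log (hpos (n + p)), ← Real.exp_add, Real.exp_le_exp]
    have := (abs_le.1 (hP (n + p))).2
    push_cast at this
    linarith
  -- The scale ε = 1 already attains the full growth rate.
  · refine le_trans ?_ (le_iSup₂ (1 : ℝ) one_pos)
    refine le_limsup_log_div (C := -c) fun n : ℕ =>
      le_trans (ENNReal.ofReal_le_ofReal ?_) (partitionSup_one_ge ξ n o)
    rw [← Real.exp_log (hpos n), Real.exp_le_exp]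
    linarith [(abs_le.1 (hP n)).1]

theorem abs_log_transfer_sub_le {ξ : C(FullShift k, ℝ)} {M : ℝ} (hM : CylVariationLE ξ M)
    (o : FullShift k) (n : ℕ) :
    |Real.log (transfer ξ n 1 o) - n * pressure (shift k) ξ| ≤ M := by
  have hpos (n : ℕ) := transfer_one_pos ξ n o
  obtain ⟨P, hP⟩ := exists_abs_sub_mul_le (s := fun n => Real.log (transfer ξ n 1 o)) (c := M)
    fun m n => by
      have h₁ := Real.log_le_log (hpos _) (transfer_add_one_le hM m n o)
      have h₂ := Real.log_le_log (mul_pos (hpos m) (hpos n)) (le_transfer_add_one hM m n o)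
      rw [Real.log_mul (Real.exp_pos _).ne' (mul_pos (hpos m) (hpos n)).ne', Real.log_exp,
        Real.log_mul (hpos m).ne' (hpos n).ne'] at h₁
      rw [Real.log_mul (Real.exp_pos _).ne' (hpos _).ne', Real.log_exp,
        Real.log_mul (hpos m).ne' (hpos n).ne'] at h₂
      rw [abs_le]
      constructor <;> linarith
  rw [pressure_eq_of_transfer hM o hP]
  exact hP n

end Pressure

/-! ### Invariant weak limits of orbit averages -/

section InvariantLimit

variable {X : Type*} [TopologicalSpace X] [MeasurableSpace X] [BorelSpace X]

/-- The average of the push-forwards of `μ` under the first `N + 1` iterates of `T`. -/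
noncomputable def orbitAverage (T : C(X, X)) (μ : Measure X) (N : ℕ) : Measure X :=
  ((N + 1 : ℕ) : ℝ≥0∞)⁻¹ • ∑ j ∈ Finset.range (N + 1), μ.map T^[j]

theorem measurable_iterate (T : C(X, X)) (j : ℕ) : Measurable T^[j] :=
  (T.continuous.iterate j).measurable

instance isProbabilityMeasure_orbitAverage (T : C(X, X)) (μ : Measure X) [IsProbabilityMeasure μ]
    (N : ℕ) : IsProbabilityMeasure (orbitAverage T μ N) := by
  constructor
  have h (j : ℕ) : μ.map T^[j] Set.univ = 1 := by
    rw [Measure.map_apply (measurable_iterate T j) MeasurableSet.univ, Set.preimage_univ,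
      measure_univ]
  rw [orbitAverage, Measure.smul_apply, Measure.finsetSum_apply, Finset.sum_congr rfl fun j _ => h j]
  simp only [Finset.sum_const, Finset.card_range, nsmul_eq_mul, mul_one, smul_eq_mul]
  exact ENNReal.inv_mul_cancel (by simp) (by simp)

variable [CompactSpace X]

theorem integrable_of_continuousMap (μ : Measure X) [IsFiniteMeasure μ] (f : C(X, ℝ)) :
    Integrable f μ :=
  Integrable.of_bound f.continuous.measurable.aestronglyMeasurable ‖f‖
    (Eventually.of_forall f.norm_coe_le_norm)

theorem integral_orbitAverage (T : C(X, X)) (μ : Measure X) [IsProbabilityMeasure μ] (N : ℕ)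
    (f : C(X, ℝ)) : ∫ x, f x ∂(orbitAverage T μ N) =
      ((N + 1 : ℕ) : ℝ)⁻¹ * ∑ j ∈ Finset.range (N + 1), ∫ x, f (T^[j] x) ∂μ := by
  have h (j : ℕ) : IsProbabilityMeasure (μ.map T^[j]) :=
    Measure.isProbabilityMeasure_map (measurable_iterate T j).aemeasurable
  rw [orbitAverage, integral_smul_measure, integral_finsetSum_measure fun j _ =>
    integrable_of_continuousMap _ f]
  rw [smul_eq_mul, ENNReal.toReal_inv, ENNReal.toReal_natCast]
  congr 1
  exact Finset.sum_congr rfl fun j _ => integral_map (measurable_iterate T j).aemeasurable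
    f.continuous.measurable.aestronglyMeasurable

/-- Composing with T shifts the averaged sum by one index, so the difference telescopes to its two
end terms. -/
theorem abs_integral_comp_sub_integral_orbitAverage_le (T : C(X, X)) (μ : Measure X)
    [IsProbabilityMeasure μ] (N : ℕ) (f : C(X, ℝ)) :
    |∫ x, (f.comp T) x ∂(orbitAverage T μ N) - ∫ x, f x ∂(orbitAverage T μ N)| ≤
      2 * ‖f‖ / ((N : ℝ) + 1) := by
  have hb (j : ℕ) : |∫ x, f (T^[j] x) ∂μ| ≤ ‖f‖ := by
    have := norm_integral_le_of_norm_le_const (μ := μ) (f := fun x => f (T^[j] x))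
      (Eventually.of_forall fun x => f.norm_coe_le_norm (T^[j] x))
    simpa using this
  rw [integral_orbitAverage, integral_orbitAverage, ← mul_sub, ← Finset.sum_sub_distrib]
  have : ∀ j, ∫ x, (f.comp T) (T^[j] x) ∂μ = ∫ x, f (T^[j + 1] x) ∂μ := fun j => by
    simp only [Function.iterate_succ_apply', ContinuousMap.comp_apply]
  simp only [this]
  rw [Finset.sum_range_sub (fun j => ∫ x, f (T^[j] x) ∂μ), abs_mul, abs_of_nonneg (by positivity),
    inv_mul_eq_div]
  push_cast
  gcongr
  exact (abs_sub _ _).trans (by linarith [hb (N + 1), hb 0])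

/-- **Krylov–Bogoliubov**: the orbit averages of a sequence of probability measures accumulate at an
invariant probability measure, which inherits bounds on the integrals of continuous functions. -/
theorem exists_invariant_limit [TopologicalSpace.MetrizableSpace X] (T : C(X, X))
    (μ : ℕ → Measure X) [∀ N, IsProbabilityMeasure (μ N)] :
    ∃ ν : Measure X, IsProbabilityMeasure ν ∧ MeasurePreserving T ν ν ∧
      ∀ (f : C(X, ℝ)) (a b : ℝ),
        (∀ᶠ N in atTop, ∀ j ≤ N, a ≤ ∫ x, f (T^[j] x) ∂(μ N) ∧ ∫ x, f (T^[j] x) ∂(μ N) ≤ b) →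
        a ≤ ∫ x, f x ∂ν ∧ ∫ x, f x ∂ν ≤ b := by
  let ρ (N : ℕ) : ProbabilityMeasure X := ⟨orbitAverage T (μ N) N, inferInstance⟩
  let F : Ultrafilter ℕ := hyperfilter ℕ
  have hF : (F : Filter ℕ) ≤ atTop := Nat.hyperfilter_le_atTop
  -- Probability measures on a compact metrizable space are weakly compact, so convergence along an
  -- ultrafilter finer than `atTop` replaces passing to a subsequence.
  obtain ⟨ν, hν⟩ : ∃ ν, Tendsto ρ F (𝓝 ν) := ⟨_, (F.map ρ).le_nhds_lim⟩
  have hint (f : C(X, ℝ)) : Tendsto (fun N => ∫ x, f x ∂(orbitAverage T (μ N) N)) F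
      (𝓝 (∫ x, f x ∂(ν : Measure X))) :=
    ProbabilityMeasure.tendsto_iff_forall_integral_tendsto.1 hν
      (BoundedContinuousFunction.mkOfCompact f)
  refine ⟨ν, inferInstance, ⟨T.continuous.measurable, ?_⟩, fun f a b h => ?_⟩
  · have : IsProbabilityMeasure (Measure.map T (ν : Measure X)) :=
      Measure.isProbabilityMeasure_map T.continuous.measurable.aemeasurable
    refine ext_of_forall_integral_eq_of_IsFiniteMeasure fun f => ?_
    rw [integral_map T.continuous.measurable.aemeasurable
      f.continuous.measurable.aestronglyMeasurable]
    have h₁ := (hint (f.toContinuousMap.comp T)).sub (hint f.toContinuousMap)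
    have h₂ : Tendsto (fun N : ℕ => 2 * ‖f.toContinuousMap‖ / ((N : ℝ) + 1)) F (𝓝 0) :=
      ((tendsto_const_div_atTop_nhds_zero_nat (2 * ‖f.toContinuousMap‖)).comp
        (tendsto_add_atTop_nat 1)).congr (fun N => by simp) |>.mono_left hF
    have h₃ : Tendsto (fun N => ∫ x, (f.toContinuousMap.comp T) x ∂(orbitAverage T (μ N) N) -
        ∫ x, f.toContinuousMap x ∂(orbitAverage T (μ N) N)) F (𝓝 0) := squeeze_zero_norm (fun N =>
      abs_integral_comp_sub_integral_orbitAverage_le T (μ N) N f.toContinuousMap) h₂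
    exact sub_eq_zero.1 (tendsto_nhds_unique h₁ h₃)
  · have hev : ∀ᶠ N in F, a ≤ ∫ x, f x ∂(orbitAverage T (μ N) N) ∧
        ∫ x, f x ∂(orbitAverage T (μ N) N) ≤ b := by
      filter_upwards [hF h] with N hN
      rw [integral_orbitAverage, inv_mul_eq_div, le_div_iff₀ (by positivity),
        div_le_iff₀ (by positivity)]
      constructor
      · calc a * ((N + 1 : ℕ) : ℝ) = ∑ j ∈ Finset.range (N + 1), a := by simp [mul_comm]
          _ ≤ _ := Finset.sum_le_sum fun j hj =>
            (hN j (Nat.lt_succ_iff.1 (Finset.mem_range.1 hj))).1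
      · calc _ ≤ ∑ j ∈ Finset.range (N + 1), b := Finset.sum_le_sum fun j hj =>
            (hN j (Nat.lt_succ_iff.1 (Finset.mem_range.1 hj))).2
          _ = _ := by simp [mul_comm]
    exact ⟨ge_of_tendsto (hint f) (hev.mono fun _ h => h.1),
      le_of_tendsto (hint f) (hev.mono fun _ h => h.2)⟩

end InvariantLimit

/-! ### Birkhoff sums of weak coboundaries -/

section WeakCoboundary

variable {X : Type*} [TopologicalSpace X]

theorem birkhoffSumC_apply (T : C(X, X)) (φ : C(X, ℝ)) (n : ℕ) (x : X) :
    birkhoffSumC T φ n x = birkhoffSum T φ n x := rfl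

theorem birkhoffSumC_add (T : C(X, X)) (φ ψ : C(X, ℝ)) (n : ℕ) :
    birkhoffSumC T (φ + ψ) n = birkhoffSumC T φ n + birkhoffSumC T ψ n := by
  ext x
  simp [birkhoffSumC_apply, birkhoffSum, Finset.sum_add_distrib]

variable [CompactSpace X]

theorem norm_birkhoffSumC_le (T : C(X, X)) (φ : C(X, ℝ)) (n : ℕ) :
    ‖birkhoffSumC T φ n‖ ≤ n * ‖φ‖ := by
  rw [ContinuousMap.norm_le _ (by positivity)]
  intro x
  rw [birkhoffSumC_apply, birkhoffSum]
  refine (norm_sum_le _ _).trans ?_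
  refine (Finset.sum_le_sum fun i _ => φ.norm_coe_le_norm (T^[i] x)).trans ?_
  simp

theorem IsCoboundary.exists_norm_birkhoffSumC_le {T : C(X, X)} {u : C(X, ℝ)}
    (hu : IsCoboundary T u) : ∃ B : ℝ, ∀ n, ‖birkhoffSumC T u n‖ ≤ B := by
  obtain ⟨q, hq⟩ := hu
  refine ⟨2 * ‖q‖, fun n => (ContinuousMap.norm_le _ (by positivity)).2 fun x => ?_⟩
  have : birkhoffSum T u n x = q (T^[n] x) - q x := by
    simp only [birkhoffSum, hq, ← Function.iterate_succ_apply' (f := T)]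
    exact Finset.sum_range_sub (fun j => q (T^[j] x)) n
  rw [birkhoffSumC_apply, this]
  refine (norm_sub_le _ _).trans ?_
  linarith [q.norm_coe_le_norm (T^[n] x), q.norm_coe_le_norm x]

/-- The Birkhoff averages of a weak coboundary converge uniformly to zero. -/
theorem IsWeakCoboundary.tendsto_norm_birkhoffSumC_div {T : C(X, X)} {u : C(X, ℝ)}
    (hu : IsWeakCoboundary T u) :
    Tendsto (fun n : ℕ => ‖birkhoffSumC T u n‖ / (n : ℝ)) atTop (𝓝 0) := by
  rw [Metric.tendsto_atTop]
  intro ε hε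
  -- With v a coboundary within ε/2 of u, S_n v telescopes and is bounded by B, so ‖S_n u‖/n is at
  -- most ‖u - v‖ + B/n; N is chosen to make B/n < ε/2.
  obtain ⟨v, hv, huv⟩ := Metric.mem_closure_iff.1 hu (ε / 2) (by positivity)
  obtain ⟨B, hB⟩ := IsCoboundary.exists_norm_birkhoffSumC_le hv
  obtain ⟨N, hN⟩ := exists_nat_gt (2 * B / ε)
  refine ⟨N + 1, fun n hn => ?_⟩
  have hn₁ : (N : ℝ) + 1 ≤ n := by exact_mod_cast hn
  have hn₀ : (0 : ℝ) < n := by linarith [(Nat.cast_nonneg N : (0 : ℝ) ≤ N)]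
  have h₁ : ‖birkhoffSumC T u n‖ ≤ n * ‖u - v‖ + B := by
    have : u = (u - v) + v := by simp
    calc ‖birkhoffSumC T u n‖ = ‖birkhoffSumC T (u - v) n + birkhoffSumC T v n‖ := by
          rw [← birkhoffSumC_add, ← this]
      _ ≤ _ := (norm_add_le _ _).trans (add_le_add (norm_birkhoffSumC_le T _ n) (hB n))
  rw [dist_eq_norm] at huv
  rw [Real.dist_eq, sub_zero, abs_of_nonneg (by positivity), div_lt_iff₀ hn₀]
  rw [div_lt_iff₀ hε] at hN
  nlinarith

/-- The Birkhoff sums of a weak coboundary vanish along periodic orbits. -/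
theorem IsWeakCoboundary.birkhoffSum_eq_zero {T : C(X, X)} {u : C(X, ℝ)}
    (hu : IsWeakCoboundary T u) {n : ℕ} (hn : 1 ≤ n) {x : X} (hx : T^[n] x = x) :
    birkhoffSum T u n x = 0 := by
  -- Going m times round the orbit multiplies the sum by m, so the average is the same at every time
  -- n * m, while these averages tend to zero.
  have hmul (m : ℕ) : birkhoffSum T u (n * m) x = m * birkhoffSum T u n x := by
    induction m with
    | zero => simp
    | succ m ih =>
      rw [Nat.mul_succ, birkhoffSum_add, ih, Function.iterate_mul,
        Function.iterate_fixed hx m]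
      push_cast
      ring
  have hn₀ : (0 : ℝ) < n := by exact_mod_cast hn
  have h₁ : Tendsto (fun m : ℕ => n * m) atTop atTop :=
    tendsto_id.const_mul_atTop' (by omega)
  have h₂ := hu.tendsto_norm_birkhoffSumC_div.comp h₁
  have h₃ : |birkhoffSum T u n x| / n ≤ 0 := by
    refine ge_of_tendsto h₂ ?_
    filter_upwards [eventually_gt_atTop 0] with m hm
    have hm₀ : (0 : ℝ) < m := by exact_mod_cast hm
    have h₄ := (birkhoffSumC T u (n * m)).norm_coe_le_norm x
    rw [birkhoffSumC_apply, hmul, Real.norm_eq_abs, abs_mul, abs_of_pos hm₀] at h₄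
    simp only [Function.comp_apply, Nat.cast_mul]
    rw [div_le_div_iff₀ hn₀ (by positivity)]
    nlinarith
  have h₅ : |birkhoffSum T u n x| ≤ 0 := by
    rwa [div_le_iff₀ hn₀, zero_mul] at h₃
  exact abs_nonpos_iff.1 h₅

end WeakCoboundary

/-! ### Bounded variation and periodic points -/

section Periodic

variable {k : ℕ}

/-- A weak coboundary on the full shift whose Birkhoff sums have bounded oscillation on cylinders
has uniformly bounded Birkhoff sums. -/
theorem IsWeakCoboundary.abs_birkhoffSum_le {u : C(FullShift k, ℝ)}
    (hu : IsWeakCoboundary (shift k) u) {M : ℝ} (hM : CylVariationLE u M) {n : ℕ} (hn : 1 ≤ n)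
    (x : FullShift k) : |birkhoffSum (shift k) u n x| ≤ M := by
  -- The comparison point repeats the first n symbols of x: it shares the n-cylinder of x, and S_n u
  -- vanishes there.
  have hper : (shift k)^[n] (fun i => x (i % n)) = fun i => x (i % n) := by
    ext i
    rw [shift_iterate_apply, Nat.add_mod_right]
  have h := hM n x (fun i => x (i % n)) fun i hi => by rw [Nat.mod_eq_of_lt hi]
  rwa [hu.birkhoffSum_eq_zero hn hper, sub_zero] at h

theorem CylVariationLE.of_add {u ξ : C(FullShift k, ℝ)} {M L : ℝ}
    (h : CylVariationLE (u + ξ : C(FullShift k, ℝ)) M) (hξ : CylVariationLE ξ L) :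
    CylVariationLE u (M + L) := by
  intro n x y hxy
  have h₁ := h n x y hxy
  have h₂ := hξ n x y hxy
  have h₃ (z : FullShift k) : birkhoffSum (shift k) (u + ξ : C(FullShift k, ℝ)) n z =
      birkhoffSum (shift k) u n z + birkhoffSum (shift k) ξ n z := by
    simp [birkhoffSum, Finset.sum_add_distrib]
  rw [h₃, h₃] at h₁
  rw [abs_le] at h₁ h₂ ⊢
  constructor <;> linarith [h₁.1, h₁.2, h₂.1, h₂.2]

end Periodic

/-! ### Construction and consequences of the Gibbs measure -/

section Gibbs

variable {k : ℕ}

/-- The indicator function of a cylinder as a continuous function. -/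
noncomputable def cylIndicator {n : ℕ} (w : Fin n → Fin k) : C(FullShift k, ℝ) where
  toFun := (cyl w).indicator 1
  continuous_toFun := continuous_one.indicator fun x hx => by
    simp [(isClopen_cyl w).frontier_eq] at hx

theorem integral_cylIndicator (μ : Measure (FullShift k)) {n : ℕ} (w : Fin n → Fin k) :
    ∫ x, cylIndicator w x ∂μ = μ.real (cyl w) :=
  integral_indicator_one (isClopen_cyl w).isOpen.measurableSet

/-- The probability measure on the words of length `N`, each followed by `o`, with weights
proportional to the exponentials of the Birkhoff sums of `ξ`. -/
noncomputable def wordMeasure (ξ : FullShift k → ℝ) (o : FullShift k) (N : ℕ) :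
    Measure (FullShift k) :=
  ∑ w : Fin N → Fin k,
    ENNReal.ofReal (Real.exp (birkhoffSum (shift k) ξ N (prepend w o)) / transfer ξ N 1 o) •
      Measure.dirac (prepend w o)

instance isProbabilityMeasure_wordMeasure (ξ : FullShift k → ℝ) (o : FullShift k) (N : ℕ) :
    IsProbabilityMeasure (wordMeasure ξ o N) := by
  have hpos := transfer_one_pos ξ N o
  constructor
  simp only [wordMeasure, Measure.finsetSum_apply, Measure.smul_apply, measure_univ, smul_eq_mul,
    mul_one]
  rw [← ENNReal.ofReal_sum_of_nonneg fun _ _ => by positivity, ← Finset.sum_div]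
  have : ∑ w : Fin N → Fin k, Real.exp (birkhoffSum (shift k) ξ N (prepend w o)) =
      transfer ξ N 1 o := by simp [transfer]
  rw [this, div_self hpos.ne', ENNReal.ofReal_one]

theorem integral_wordMeasure (ξ : FullShift k → ℝ) (o : FullShift k) (N : ℕ)
    (g : C(FullShift k, ℝ)) :
    ∫ x, g x ∂(wordMeasure ξ o N) = transfer ξ N g o / transfer ξ N 1 o := by
  have hpos := transfer_one_pos ξ N o
  rw [wordMeasure, integral_finsetSum_measure fun w _ =>
    (integrable_of_continuousMap _ g).smul_measure ENNReal.ofReal_ne_top]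
  rw [transfer.eq_def ξ N g, Finset.sum_div]
  refine Finset.sum_congr rfl fun w _ => ?_
  rw [integral_smul_measure, integral_dirac, ENNReal.toReal_ofReal (by positivity), smul_eq_mul]
  ring

variable {ξ : FullShift k → ℝ} {M : ℝ}

/-- Bounds for the transfer operator on the indicator of a cylinder pulled back by an iterate of the
shift. -/
theorem transfer_cyl_bounds (hM : CylVariationLE ξ M) (o : FullShift k) (j r : ℕ) {n : ℕ}
    {w : Fin n → Fin k} {x : FullShift k} (hx : x ∈ cyl w) :
    transfer ξ (j + (n + r)) (fun y => (cyl w).indicator 1 ((shift k)^[j] y)) o ≤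
        Real.exp M ^ 2 * (transfer ξ j 1 o * (Real.exp (birkhoffSum (shift k) ξ n x) *
          transfer ξ r 1 o)) ∧
      transfer ξ j 1 o * (Real.exp (birkhoffSum (shift k) ξ n x) * transfer ξ r 1 o) ≤
        Real.exp M ^ 2 *
          transfer ξ (j + (n + r)) (fun y => (cyl w).indicator 1 ((shift k)^[j] y)) o := by
  have hj := transfer_one_pos ξ j o
  -- The pulled-back cylinder fixes the middle block of a word split as j + n + r. The first j steps
  -- leave the indicator times Z_j; replacing Z_j(y) by Z_j(o), then the Birkhoff sum at the
  -- prefixed point by that at x, costs e^M each.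
  have heq : transfer ξ (j + (n + r)) (fun y => (cyl w).indicator 1 ((shift k)^[j] y)) =
      transfer ξ r (transfer ξ n (fun y => (cyl w).indicator 1 y * transfer ξ j 1 y)) := by
    rw [transfer_add, transfer_add]
    have := transfer_comp_mul ξ j ((cyl w).indicator 1) 1
    simp only [Pi.one_apply, mul_one] at this
    rw [this]
  have hind (y : FullShift k) : 0 ≤ (cyl w).indicator (1 : FullShift k → ℝ) y :=
    Set.indicator_nonneg (fun _ _ => zero_le_one) y
  have hx' (y : FullShift k) := exp_birkhoffSum_le hM (prepend_mem_cyl w y) hx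
  have hx'' (y : FullShift k) := exp_birkhoffSum_le hM hx (prepend_mem_cyl w y)
  rw [heq]
  constructor
  · have h₁ (y : FullShift k) :
        transfer ξ n (fun y => (cyl w).indicator 1 y * transfer ξ j 1 y) y ≤
          Real.exp M ^ 2 * transfer ξ j 1 o * Real.exp (birkhoffSum (shift k) ξ n x) := by
      calc _ ≤ transfer ξ n (fun y => (Real.exp M * transfer ξ j 1 o) *
            (cyl w).indicator 1 y) y := transfer_mono ξ n (fun y => by
              rw [mul_comm]
              exact mul_le_mul_of_nonneg_right (transfer_one_le hM j y o) (hind y)) y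
        _ = Real.exp M * transfer ξ j 1 o *
            Real.exp (birkhoffSum (shift k) ξ n (prepend w y)) := by
          rw [transfer_const_mul, transfer_indicator_cyl]
        _ ≤ Real.exp M * transfer ξ j 1 o *
            (Real.exp M * Real.exp (birkhoffSum (shift k) ξ n x)) := by gcongr; exact hx' y
        _ = _ := by ring
    refine (transfer_mono ξ r h₁ o).trans (le_of_eq ?_)
    rw [transfer_const]
    ring
  · have h₁ (y : FullShift k) :
        transfer ξ j 1 o * Real.exp (birkhoffSum (shift k) ξ n x) ≤
          Real.exp M ^ 2 * transfer ξ n (fun y => (cyl w).indicator 1 y * transfer ξ j 1 y) y := by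
      calc _ ≤ transfer ξ j 1 o *
            (Real.exp M * Real.exp (birkhoffSum (shift k) ξ n (prepend w y))) := by
              gcongr; exact hx'' y
        _ = Real.exp M * transfer ξ n (fun y => transfer ξ j 1 o * (cyl w).indicator 1 y) y := by
          rw [transfer_const_mul, transfer_indicator_cyl]
          ring
        _ ≤ Real.exp M * transfer ξ n (fun y => Real.exp M *
            ((cyl w).indicator 1 y * transfer ξ j 1 y)) y := by
          gcongr
          refine transfer_mono ξ n (fun y => ?_) y
          have := mul_le_mul_of_nonneg_right (transfer_one_le hM j o y) (hind y)
          linarith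
        _ = _ := by rw [transfer_const_mul]; ring
    have h₂ := transfer_mono ξ r h₁ o
    rw [transfer_const, transfer_const_mul] at h₂
    linarith

theorem transfer_triple_bounds (hM : CylVariationLE ξ M) (o : FullShift k) (j n r : ℕ) :
    transfer ξ (j + (n + r)) 1 o ≤
        Real.exp M ^ 2 * (transfer ξ j 1 o * (transfer ξ n 1 o * transfer ξ r 1 o)) ∧
      transfer ξ j 1 o * (transfer ξ n 1 o * transfer ξ r 1 o) ≤
        Real.exp M ^ 2 * transfer ξ (j + (n + r)) 1 o := by
  have hj := transfer_one_pos ξ j o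
  constructor
  · calc _ ≤ Real.exp M * (transfer ξ j 1 o * transfer ξ (n + r) 1 o) :=
          transfer_add_one_le hM j (n + r) o
      _ ≤ Real.exp M * (transfer ξ j 1 o *
          (Real.exp M * (transfer ξ n 1 o * transfer ξ r 1 o))) := by
        gcongr; exact transfer_add_one_le hM n r o
      _ = _ := by ring
  · calc _ ≤ transfer ξ j 1 o * (Real.exp M * transfer ξ (n + r) 1 o) := by
          exact mul_le_mul_of_nonneg_left (le_transfer_add_one hM n r o) hj.le
      _ = Real.exp M * (transfer ξ j 1 o * transfer ξ (n + r) 1 o) := by ring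
      _ ≤ Real.exp M * (Real.exp M * transfer ξ (j + (n + r)) 1 o) := by
        exact mul_le_mul_of_nonneg_left (le_transfer_add_one hM j (n + r) o) (Real.exp_nonneg M)
      _ = _ := by ring

/-- Cylinders pulled back by iterates of the shift have the Gibbs bounds for the word measures. -/
theorem wordMeasure_cyl_bounds {ξ : C(FullShift k, ℝ)} (hM : CylVariationLE ξ M) (o : FullShift k)
    (j r : ℕ) {n : ℕ} {w : Fin n → Fin k} {x : FullShift k} (hx : x ∈ cyl w) :
    (Real.exp M ^ 5)⁻¹ * Real.exp (-(n * pressure (shift k) ξ) + birkhoffSum (shift k) ξ n x) ≤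
        ∫ y, cylIndicator w ((shift k)^[j] y) ∂(wordMeasure ξ o (j + (n + r))) ∧
      ∫ y, cylIndicator w ((shift k)^[j] y) ∂(wordMeasure ξ o (j + (n + r))) ≤
        Real.exp M ^ 5 *
          Real.exp (-(n * pressure (shift k) ξ) + birkhoffSum (shift k) ξ n x) := by
  have hI := integral_wordMeasure ξ o (j + (n + r))
    ((cylIndicator w).comp ⟨(shift k)^[j], (shift k).continuous.iterate j⟩)
  change ∫ y, cylIndicator w ((shift k)^[j] y) ∂(wordMeasure ξ o (j + (n + r))) =
    transfer ξ (j + (n + r)) (fun y => (cyl w).indicator 1 ((shift k)^[j] y)) o / _ at hI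
  rw [hI]
  obtain ⟨h₁, h₂⟩ := transfer_cyl_bounds hM o j r hx
  -- The exponent 5 counts two factors e^M for the numerator, two for splitting the normalising sum
  -- as Z_j Z_n Z_r, and one for replacing Z_n by exp(nP).
  obtain ⟨h₃, h₄⟩ := transfer_triple_bounds hM o j n r
  have hZ := abs_le.1 (abs_log_transfer_sub_le hM o n)
  have hj := transfer_one_pos ξ j o
  have hn := transfer_one_pos ξ n o
  have hr := transfer_one_pos ξ r o
  have ht := transfer_one_pos ξ (j + (n + r)) o
  have h₅ : transfer ξ n 1 o * Real.exp (-(n * pressure (shift k) ξ)) ≤ Real.exp M := by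
    conv_lhs => rw [← Real.exp_log hn]
    rw [← Real.exp_add, Real.exp_le_exp]
    linarith
  have h₆ : 1 ≤ Real.exp M * (transfer ξ n 1 o * Real.exp (-(n * pressure (shift k) ξ))) := by
    conv_rhs => rw [← Real.exp_log hn]
    rw [← Real.exp_add, ← Real.exp_add, Real.one_le_exp_iff]
    linarith
  rw [Real.exp_add]
  have hE := Real.exp_pos M
  have hb := Real.exp_pos (birkhoffSum (shift k) ξ n x)
  have hp := Real.exp_pos (-(n * pressure (shift k) ξ))
  generalize transfer ξ (j + (n + r)) (fun y => (cyl w).indicator 1 ((shift k)^[j] y)) o = I at *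
  generalize transfer ξ (j + (n + r)) 1 o = Z at *
  generalize transfer ξ j 1 o = Zj at *
  generalize transfer ξ n 1 o = Zn at *
  generalize transfer ξ r 1 o = Zr at *
  generalize Real.exp M = E at *
  generalize Real.exp (birkhoffSum (shift k) ξ n x) = b at *
  generalize Real.exp (-(n * pressure (shift k) ξ)) = p at *
  constructor
  · rw [inv_mul_le_iff₀ (by positivity), ← mul_div_assoc, le_div_iff₀ ht]
    calc p * b * Z ≤ p * b * (E ^ 2 * (Zj * (Zn * Zr))) := by gcongr
      _ = E ^ 2 * (Zn * p) * (Zj * (b * Zr)) := by ring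
      _ ≤ E ^ 2 * E * (E ^ 2 * I) := by gcongr
      _ = E ^ 5 * I := by ring
  · rw [div_le_iff₀ ht]
    calc I ≤ E ^ 2 * (Zj * (b * Zr)) * 1 := by rw [mul_one]; exact h₁
      _ ≤ E ^ 2 * (Zj * (b * Zr)) * (E * (Zn * p)) := by gcongr
      _ = E ^ 3 * p * b * (Zj * (Zn * Zr)) := by ring
      _ ≤ E ^ 3 * p * b * (E ^ 2 * Z) := by gcongr
      _ = E ^ 5 * (p * b) * Z := by ring

/-- A continuous potential with bounded oscillation on cylinders has an invariant Gibbs measure. -/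
theorem exists_invariant_gibbs (o : FullShift k) {ξ : C(FullShift k, ℝ)} (hM₀ : 0 ≤ M)
    (hM : CylVariationLE ξ M) :
    ∃ ν : Measure (FullShift k), IsProbabilityMeasure ν ∧ MeasurePreserving (shift k) ν ν ∧
      IsGibbs ν ξ := by
  -- Words of length 2N leave room for an n-block at every averaged position j ≤ N as soon as N ≥ n.
  obtain ⟨ν, hν, hinv, hb⟩ := exists_invariant_limit (shift k) fun N => wordMeasure ξ o (2 * N)
  refine ⟨ν, hν, hinv, Real.exp M ^ 5, one_le_pow₀ (Real.one_le_exp hM₀), fun n _ w x hx => ?_⟩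
  have h := hb (cylIndicator w) _ _ (by
    filter_upwards [eventually_ge_atTop n] with N hN j hj
    have h := wordMeasure_cyl_bounds hM o j (2 * N - j - n) hx
    rwa [show j + (n + (2 * N - j - n)) = 2 * N by omega] at h)
  rw [integral_cylIndicator] at h
  rwa [le_div_iff₀ (Real.exp_pos _), div_le_iff₀ (Real.exp_pos _)]

theorem IsGibbs.real_cyl_pos {μ : Measure (FullShift k)} {ξ : FullShift k → ℝ} (h : IsGibbs μ ξ)
    {n : ℕ} (hn : 1 ≤ n) {w : Fin n → Fin k} {x : FullShift k} (hx : x ∈ cyl w) :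
    0 < μ.real (cyl w) := by
  obtain ⟨K, hK, h⟩ := h
  have h₁ := (h n hn w x hx).1
  rw [le_div_iff₀ (Real.exp_pos _)] at h₁
  exact lt_of_lt_of_le (by positivity) h₁

theorem IsGibbs.exists_abs_log_sub_le {μ : Measure (FullShift k)} {ξ : FullShift k → ℝ}
    (h : IsGibbs μ ξ) : ∃ c : ℝ, 0 ≤ c ∧ ∀ n : ℕ, 1 ≤ n → ∀ w : Fin n → Fin k, ∀ x ∈ cyl w,
      |Real.log (μ.real (cyl w)) + n * pressure (shift k) ξ - birkhoffSum (shift k) ξ n x| ≤ c := by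
  have hpos := @IsGibbs.real_cyl_pos k μ ξ h
  obtain ⟨K, hK, h⟩ := h
  refine ⟨Real.log K, Real.log_nonneg hK, fun n hn w x hx => ?_⟩
  have hp := hpos hn hx
  obtain ⟨h₁, h₂⟩ := h n hn w x hx
  have h₁ := Real.log_le_log (by positivity) h₁
  have h₂ := Real.log_le_log (by positivity) h₂
  rw [Real.log_div hp.ne' (Real.exp_pos _).ne', Real.log_exp] at h₁ h₂
  rw [Real.log_inv] at h₁
  rw [abs_le]
  constructor <;> linarith

theorem IsGibbs.exists_abs_log_append_le {μ : Measure (FullShift k)} {ξ : FullShift k → ℝ}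
    (h : IsGibbs μ ξ) (o : FullShift k) :
    ∃ c : ℝ, 0 ≤ c ∧ ∀ n m : ℕ, 1 ≤ n → 1 ≤ m → ∀ (w : Fin n → Fin k) (v : Fin m → Fin k),
      |Real.log (μ.real (cyl (Fin.append w v))) - Real.log (μ.real (cyl w)) -
        Real.log (μ.real (cyl v))| ≤ c := by
  obtain ⟨c, hc, h⟩ := h.exists_abs_log_sub_le
  -- Three Gibbs estimates along one orbit: at a point of the joint cylinder for w followed by v and
  -- for w, and at its n-th shift for v. The Birkhoff sums and pressure terms cancel by additivity.
  refine ⟨3 * c, by positivity, fun n m hn hm w v => ?_⟩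
  have hx := prepend_mem_cyl (Fin.append w v) o
  obtain ⟨hw, hv⟩ := (mem_cyl_append_iff w v _).1 hx
  have h₁ := abs_le.1 (h (n + m) (by omega) _ _ hx)
  have h₂ := abs_le.1 (h n hn _ _ hw)
  have h₃ := abs_le.1 (h m hm _ _ hv)
  rw [birkhoffSum_add (shift k) ξ n m] at h₁
  push_cast at h₁
  rw [abs_le]
  constructor <;> linarith [h₁.1, h₁.2, h₂.1, h₂.2, h₃.1, h₃.2]

theorem IsGibbs.isQuasiBernoulli {μ : Measure (FullShift k)} {ξ : FullShift k → ℝ}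
    (h : IsGibbs μ ξ) (o : FullShift k) : IsQuasiBernoulli μ := by
  have hpos {n : ℕ} (hn : 1 ≤ n) (w : Fin n → Fin k) : 0 < μ.real (cyl w) :=
    h.real_cyl_pos hn (prepend_mem_cyl w o)
  obtain ⟨c, hc, h⟩ := h.exists_abs_log_append_le o
  refine ⟨hpos le_rfl, Real.exp c, Real.one_le_exp hc, fun n m hn hm w v => ?_⟩
  have h₀ := hpos (by omega : 1 ≤ n + m) (Fin.append w v)
  have h₁ := hpos hn w
  have h₂ := hpos hm v
  have h₃ := abs_le.1 (h n m hn hm w v)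
  rw [← Real.exp_neg, ← Real.le_log_iff_exp_le (by positivity),
    ← Real.log_le_iff_le_exp (by positivity), Real.log_div h₀.ne' (by positivity),
    Real.log_mul h₁.ne' h₂.ne']
  constructor <;> linarith

end Gibbs

/-! ### The sequence of cylinder logarithms -/

section CylinderLog

variable {k : ℕ}

/-- The function `x ↦ log ν(C_n(x)) + n P(ξ)`. -/
noncomputable def cylLog (ν : Measure (FullShift k)) (P : ℝ) (n : ℕ) : C(FullShift k, ℝ) where
  toFun x := Real.log (ν.real (cyl (pre x n))) + n * P
  continuous_toFun := by
    have h : Continuous fun x : FullShift k => pre x n :=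
      continuous_pi fun i => continuous_apply (i : ℕ)
    exact (continuous_of_discreteTopology (f := fun w : Fin n → Fin k =>
      Real.log (ν.real (cyl w)) + n * P)).comp h

theorem cylLog_apply (ν : Measure (FullShift k)) (P : ℝ) (n : ℕ) (x : FullShift k) :
    cylLog ν P n x = Real.log (ν.real (cyl (pre x n))) + n * P := rfl

theorem hasWaltersProperty_cylLog (ν : Measure (FullShift k)) (P : ℝ) :
    HasWaltersProperty (shift k) (fun n => cylLog ν P n) := by
  intro κ hκ
  -- Closeness below 1 along n iterates means equality of the first n symbols, so the difference is
  -- exactly zero whatever κ is.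
  refine ⟨1, one_pos, fun n _ x y h => ?_⟩
  have : pre x n = pre y n := funext fun i => by
    have := apply_zero_eq_of_dist_lt_one (h i i.2)
    rwa [shift_iterate_apply, shift_iterate_apply, zero_add] at this
  simp only [cylLog_apply]
  rw [this, sub_self, abs_zero]
  exact hκ

theorem IsGibbs.isAlmostAdditive_cylLog {ν : Measure (FullShift k)} {ξ : FullShift k → ℝ}
    (h : IsGibbs ν ξ) (o : FullShift k) (P : ℝ) :
    IsAlmostAdditive (shift k) (fun n => cylLog ν P n) := by
  obtain ⟨c, hc, h⟩ := h.exists_abs_log_append_le o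
  -- The definition asks for a strictly positive constant, and c may be 0.
  refine ⟨c + 1, by positivity, fun m n hm hn x => ?_⟩
  have := abs_le.1 (h m n hm hn (pre x m) (pre ((shift k)^[m] x) n))
  rw [append_pre] at this
  simp only [cylLog_apply]
  push_cast
  constructor <;> linarith [this.1, this.2]

theorem IsGibbs.exists_norm_cylLog_sub_le {ν : Measure (FullShift k)} {ξ : C(FullShift k, ℝ)}
    (h : IsGibbs ν ξ) : ∃ c : ℝ, ∀ n : ℕ, 1 ≤ n →
      ‖cylLog ν (pressure (shift k) ξ) n - birkhoffSumC (shift k) ξ n‖ ≤ c := by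
  obtain ⟨c, hc, h⟩ := h.exists_abs_log_sub_le
  exact ⟨c, fun n hn => (ContinuousMap.norm_le _ hc).2 fun x =>
    h n hn (pre x n) x (mem_cyl_pre x n)⟩

end CylinderLog

end Thermo

/-! ### The proposition -/

open Thermo

theorem proposition4p9 (k : ℕ) (hk : 1 ≤ k) (φ u ξ : C(FullShift k, ℝ))
    (hu : IsWeakCoboundary (shift k) u) (hξ : IsBowen (shift k) ξ) (hφ : φ = u + ξ) :
    ∃ (ν : Measure (FullShift k)) (f : ℕ → C(FullShift k, ℝ)),
      IsProbabilityMeasure ν ∧ MeasurePreserving (shift k) ν ν ∧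
      IsGibbs ν ξ ∧ IsQuasiBernoulli ν ∧
      (∀ n : ℕ, 1 ≤ n → ∀ x : FullShift k,
        f n x = Real.log (ν.real (cyl (pre x n))) + n * pressure (shift k) ξ) ∧
      IsAlmostAdditive (shift k) (fun n => f n) ∧
      HasWaltersProperty (shift k) (fun n => f n) ∧
      PhysicallyEquivalent f (birkhoffSumC (shift k) φ) ∧
      (IsBowen (shift k) φ →
        ∃ K : ℝ, ∀ n : ℕ, 1 ≤ n → ‖f n - birkhoffSumC (shift k) φ n‖ ≤ K) := by
  let o : FullShift k := fun _ => ⟨0, hk⟩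
  obtain ⟨M, hM₀, hM⟩ := hξ.exists_cyl_bound
  obtain ⟨ν, hν, hinv, hG⟩ := exists_invariant_gibbs o hM₀ hM
  obtain ⟨c, hc⟩ := hG.exists_norm_cylLog_sub_le
  have hle (n : ℕ) (hn : 1 ≤ n) :
      ‖cylLog ν (pressure (shift k) ξ) n - birkhoffSumC (shift k) φ n‖ ≤
        c + ‖birkhoffSumC (shift k) u n‖ := by
    rw [hφ, birkhoffSumC_add, add_comm (birkhoffSumC (shift k) u n), ← sub_sub]
    exact (norm_sub_le _ _).trans (add_le_add_left (hc n hn) _)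
  refine ⟨ν, cylLog ν (pressure (shift k) ξ), hν, hinv, hG, hG.isQuasiBernoulli o,
    fun n _ x => cylLog_apply ν _ n x, hG.isAlmostAdditive_cylLog o _,
    hasWaltersProperty_cylLog ν _, ?_, fun hB => ?_⟩
  · have h := (tendsto_const_div_atTop_nhds_zero_nat c).add hu.tendsto_norm_birkhoffSumC_div
    rw [add_zero] at h
    refine squeeze_zero' (Eventually.of_forall fun n => by positivity) ?_ h
    filter_upwards [eventually_ge_atTop 1] with n hn
    rw [← add_div]
    exact div_le_div_of_nonneg_right (hle n hn) (Nat.cast_nonneg n)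
  · obtain ⟨L, hL₀, hL⟩ := hB.exists_cyl_bound
    rw [hφ] at hL
    -- As the difference of S_n φ and S_n ξ, S_n u varies boundedly on cylinders, so the
    -- periodic-point bound applies to it.
    have hu' := hL.of_add hM
    refine ⟨c + (L + M), fun n hn => (hle n hn).trans (add_le_add_right ?_ c)⟩
    exact (ContinuousMap.norm_le _ (by positivity)).2 fun x => hu.abs_birkhoffSum_le hu' hn x
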